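/- For a set $X\subseteq\mathbb{N}$ let $R_X$ be the equivalence relation on $\mathbb{N}$ given by $x\mathrel{R_X}y$ if and only if $x,y\in X$ or $x=y$. Call an equivalence relation on $\mathbb{N}$ punctual if it is primitive recursive and has infinitely many equivalence classes. For equivalence relations $R,S$ on $\mathbb{N}$ write $R\leq_{pr}S$ if there is a primitive recursive function $f:\mathbb{N}\to\mathbb{N}$ such that for all $x,y\in\mathbb{N}$, $x\mathrel{R}y$ if and only if $f(x)\mathrel{S}f(y)$; write $R<_{pr}S$ if $R\leq_{pr}S$ and $S\not\leq_{pr}R$. **Theorem 6.1 (Density).** If $R_X$ and $R_Z$ are punctual equivalence relations with $R_X<_{pr}R_Z$, then there exists a primitive recursive set $Y\subseteq\mathbb{N}$ such that $R_X<_{pr}R_Y<_{pr}R_Z$. -/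

import Mathlib

namespace Peq

/-- The equivalence relation `R_X` on `ℕ`: `x R_X y` iff `x, y ∈ X` or `x = y`. -/
def setRel (X : Set ℕ) : Setoid ℕ where
  r x y := (x ∈ X ∧ y ∈ X) ∨ x = y
  iseqv :=
    { refl := fun _ => Or.inr rfl
      symm := by
        rintro x y (⟨hx, hy⟩ | rfl)
        · exact Or.inl ⟨hy, hx⟩
        · exact Or.inr rfl
      trans := by
        rintro x y z (⟨hx, hy⟩ | rfl) (⟨hy', hz⟩ | rfl)
        · exact Or.inl ⟨hx, hz⟩
        · exact Or.inl ⟨hx, hy⟩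
        · exact Or.inl ⟨hy', hz⟩
        · exact Or.inr rfl }

/-- A punctual equivalence relation: a primitive recursive equivalence relation on `ℕ`
with infinitely many equivalence classes. -/
def Punctual (R : Setoid ℕ) : Prop :=
  PrimrecRel (fun x y => R x y) ∧ Infinite (Quotient R)

/-- Primitive recursive reducibility `R ≤_pr S`. -/
def Reducible (R S : Setoid ℕ) : Prop :=
  ∃ f : ℕ → ℕ, Primrec f ∧ ∀ x y, R x y ↔ S (f x) (f y)

/-- Strict primitive recursive reducibility `R <_pr S`. -/
def StrictReducible (R S : Setoid ℕ) : Prop :=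
  Reducible R S ∧ ¬ Reducible S R

end Peq

open Classical in
/-- The number of elements of the complement of `X` below `n`. -/
noncomputable def Peq.complCount (X : Set ℕ) (n : ℕ) : ℕ := Nat.count (fun m => m ∉ X) n

namespace Peq

open Nat.Partrec (Code)

/-! ### The counting function of a complement -/

theorem complCount_zero (X : Set ℕ) : complCount X 0 = 0 := by
  simp [complCount]

theorem complCount_succ_of_mem {X : Set ℕ} {n : ℕ} (h : n ∈ X) :
    complCount X (n + 1) = complCount X n := by
  simp [complCount, Nat.count_succ, h]

theorem complCount_succ_of_notMem {X : Set ℕ} {n : ℕ} (h : n ∉ X) :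
    complCount X (n + 1) = complCount X n + 1 := by
  simp [complCount, Nat.count_succ, h]

theorem complCount_succ_le (X : Set ℕ) (n : ℕ) : complCount X (n + 1) ≤ complCount X n + 1 := by
  by_cases h : n ∈ X
  · rw [complCount_succ_of_mem h]; omega
  · rw [complCount_succ_of_notMem h]

theorem complCount_mono (X : Set ℕ) : Monotone (complCount X) := by
  classical
  exact Nat.count_monotone _

theorem complCount_inj {X : Set ℕ} {m n : ℕ} (hm : m ∉ X) (hn : n ∉ X)
    (h : complCount X m = complCount X n) : m = n := by
  classical
  exact Nat.count_injective (p := fun m => m ∉ X) hm hn h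

theorem primrec_complCount {X : Set ℕ} (hX : PrimrecPred fun n => n ∈ X) :
    Primrec (complCount X) := by
  classical
  have h : Primrec₂ fun (n c : ℕ) => if n ∈ X then c else c + 1 :=
    Primrec.ite (hX.comp Primrec.fst) Primrec.snd (Primrec.succ.comp Primrec.snd)
  refine (Primrec.nat_rec₁ 0 h).of_eq fun n => ?_
  induction n with
  | zero => simp [complCount_zero]
  | succ n ih =>
    by_cases hn : n ∈ X
    · simp [complCount_succ_of_mem hn, hn, ih]
    · simp [complCount_succ_of_notMem hn, hn, ih]

theorem exists_le_complCount {X : Set ℕ} (hX : Xᶜ.Infinite) (N : ℕ) :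
    ∃ n, N ≤ complCount X n := by
  induction N with
  | zero => exact ⟨0, Nat.zero_le _⟩
  | succ N ih =>
    obtain ⟨n, hn⟩ := ih
    obtain ⟨m, hm, hnm⟩ := hX.exists_gt n
    refine ⟨m + 1, ?_⟩
    rw [complCount_succ_of_notMem hm]
    have := complCount_mono X hnm.le
    omega

/-- A function with increments `0` and `1` that vanishes at `0` counts a complement. -/
theorem complCount_eq_of_lipschitz {h : ℕ → ℕ} (h0 : h 0 = 0) (hmono : ∀ n, h n ≤ h (n + 1))
    (hlip : ∀ n, h (n + 1) ≤ h n + 1) (n : ℕ) : complCount {n | h (n + 1) = h n} n = h n := by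
  induction n with
  | zero => rw [complCount_zero, h0]
  | succ n ih =>
    by_cases hn : h (n + 1) = h n
    · rw [complCount_succ_of_mem (show n ∈ {n | h (n + 1) = h n} from hn), ih, hn]
    · rw [complCount_succ_of_notMem (show n ∉ {n | h (n + 1) = h n} from hn), ih]
      have := hmono n
      have := hlip n
      omega

theorem setRel_iff {X : Set ℕ} {x y : ℕ} : setRel X x y ↔ (x ∈ X ∧ y ∈ X) ∨ x = y :=
  Iff.rfl

/-! ### Punctual relations of the form `R_X` -/

theorem Punctual.primrecPred {X : Set ℕ} (hX : Punctual (setRel X)) :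
    PrimrecPred fun n => n ∈ X := by
  classical
  rcases X.eq_empty_or_nonempty with rfl | ⟨x₀, hx₀⟩
  · exact ⟨fun _ => isFalse id, Primrec.const false⟩
  · refine (hX.1.comp Primrec.id (Primrec.const x₀)).of_eq fun n => ?_
    constructor
    · rintro (h | rfl)
      · exact h.1
      · exact hx₀
    · exact fun h => Or.inl ⟨h, hx₀⟩

theorem Punctual.infinite_compl {X : Set ℕ} (hX : Punctual (setRel X)) : Xᶜ.Infinite := by
  intro hfin
  have := hX.2
  rcases X.eq_empty_or_nonempty with rfl | ⟨x₀, hx₀⟩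
  · exact Set.infinite_univ (by simpa using hfin)
  · refine Set.infinite_univ (α := Quotient (setRel X))
      (((hfin.insert x₀).image (Quotient.mk (setRel X))).subset ?_)
    rintro q -
    induction q using Quotient.inductionOn with
    | h x =>
      by_cases hx : x ∈ X
      · exact ⟨x₀, Set.mem_insert _ _, Quotient.sound (Or.inl ⟨hx₀, hx⟩)⟩
      · exact ⟨x, Set.mem_insert_of_mem _ hx, rfl⟩

/-! ### Reducibility in terms of counting functions -/

theorem complCount_le_of_injOn {X Z : Set ℕ} {g : ℕ → ℕ} (hg : Primrec g)
    (hmaps : Set.MapsTo g Xᶜ Zᶜ) (hinj : Set.InjOn g Xᶜ) :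
    ∃ p : ℕ → ℕ, Primrec p ∧ Monotone p ∧ ∀ n, complCount X n ≤ complCount Z (p n) := by
  classical
  have hstep : Primrec₂ fun (n s : ℕ) => s + (g n + 1) :=
    Primrec.nat_add.comp Primrec.snd (Primrec.succ.comp (hg.comp Primrec.fst))
  let p : ℕ → ℕ := Nat.rec 0 fun n s => s + (g n + 1)
  have hp : ∀ n, p (n + 1) = p n + (g n + 1) := fun n => rfl
  have hmono : Monotone p := monotone_nat_of_le_succ fun n => by rw [hp]; omega
  refine ⟨p, Primrec.nat_rec₁ 0 hstep, hmono, fun n => ?_⟩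
  rw [complCount, complCount, Nat.count_eq_card_filter_range, Nat.count_eq_card_filter_range]
  refine Finset.card_le_card_of_injOn g ?_ ?_
  · intro x hx
    simp only [Finset.coe_filter, Finset.mem_range, Set.mem_ofPred_eq] at hx ⊢
    refine ⟨?_, hmaps hx.2⟩
    have := hmono (show x + 1 ≤ n from hx.1)
    rw [hp] at this
    omega
  · intro x hx y hy hxy
    simp only [Finset.coe_filter, Finset.mem_range, Set.mem_ofPred_eq] at hx hy
    exact hinj hx.2 hy.2 hxy

theorem Reducible.exists_complCount_le {X Z : Set ℕ} (h : Reducible (setRel X) (setRel Z)) :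
    ∃ p : ℕ → ℕ, Primrec p ∧ Monotone p ∧ ∀ n, complCount X n ≤ complCount Z (p n) := by
  classical
  obtain ⟨f, hf, hfr⟩ := h
  have hinj : ∀ x y, x ∉ X → f x = f y → x = y := fun x y hx hxy => by
    rcases (hfr x y).2 (Or.inr hxy) with h | h
    · exact absurd h.1 hx
    · exact h
  by_cases hex : ∃ x₀, x₀ ∉ X ∧ f x₀ ∈ Z
  swap
  · push Not at hex
    exact complCount_le_of_injOn hf hex fun x hx y _ hxy => hinj x y hx hxy
  obtain ⟨x₀, hx₀, hfx₀⟩ := hex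
  have huniq : ∀ x, f x ∈ Z → x = x₀ := fun x hx => by
    rcases (hfr x₀ x).2 (Or.inl ⟨hfx₀, hx⟩) with h | h
    · exact absurd h.1 hx₀
    · exact h.symm
  rcases X.eq_empty_or_nonempty with rfl | ⟨w, hw⟩
  · have hlt : PrimrecPred fun x : ℕ => x < x₀ := Primrec.nat_lt.comp Primrec.id (Primrec.const x₀)
    refine complCount_le_of_injOn (g := fun x => f (if x < x₀ then x else x + 1))
      (hf.comp (Primrec.ite hlt Primrec.id Primrec.succ)) ?_ ?_
    · intro x _ hx
      have := huniq _ hx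
      split_ifs at this <;> omega
    · intro x _ y _ hxy
      have := hinj _ _ (Set.notMem_empty _) hxy
      split_ifs at this <;> omega
  · have hwx : w ≠ x₀ := fun h => hx₀ (h ▸ hw)
    have heq : PrimrecPred fun x : ℕ => x = x₀ := Primrec.eq.comp Primrec.id (Primrec.const x₀)
    refine complCount_le_of_injOn (g := fun x => f (if x = x₀ then w else x))
      (hf.comp (Primrec.ite heq (Primrec.const w) Primrec.id)) ?_ ?_
    · intro x _ hx
      have := huniq _ hx
      split_ifs at this <;> tauto
    · intro x hx y hy hxy
      dsimp only at hxy
      split_ifs at hxy with h1 h2 h2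
      · rw [h1, h2]
      · exact absurd (hinj _ _ hy hxy.symm ▸ hw) hy
      · exact absurd (hinj _ _ hx hxy ▸ hw) hx
      · exact hinj _ _ hx hxy

theorem complCount_findGreatest {Z : Set ℕ} {k B : ℕ} (h : k < complCount Z B) :
    complCount Z (Nat.findGreatest (fun y => complCount Z y ≤ k) B) = k ∧
      Nat.findGreatest (fun y => complCount Z y ≤ k) B ∉ Z := by
  set w := Nat.findGreatest (fun y => complCount Z y ≤ k) B with hw
  have hwk : complCount Z w ≤ k :=
    Nat.findGreatest_spec (P := fun y => complCount Z y ≤ k) (Nat.zero_le B)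
      (by simp [complCount_zero])
  have hwB : w ≤ B := Nat.findGreatest_le B
  have hlt : w < B := lt_of_le_of_ne hwB fun hne => by rw [hne] at hwk; omega
  have hsucc : ¬ complCount Z (w + 1) ≤ k :=
    Nat.findGreatest_is_greatest (P := fun y => complCount Z y ≤ k) (Nat.lt_succ_self w) hlt
  have hnot : w ∉ Z := fun hmem => hsucc (by rwa [complCount_succ_of_mem hmem])
  rw [complCount_succ_of_notMem hnot] at hsucc
  exact ⟨by omega, hnot⟩

theorem reducible_of_complCount_le {X Z : Set ℕ} (hX : PrimrecPred fun n => n ∈ X)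
    (hZ : PrimrecPred fun n => n ∈ Z) {p : ℕ → ℕ} (hp : Primrec p)
    (h : ∀ n, complCount X n ≤ complCount Z (p n)) : Reducible (setRel X) (setRel Z) := by
  classical
  rcases Z.eq_empty_or_nonempty with rfl | ⟨z₀, hz₀⟩
  · refine ⟨fun x => if x ∈ X then 0 else x + 1,
      Primrec.ite hX (Primrec.const 0) Primrec.succ, fun x y => ?_⟩
    by_cases hx : x ∈ X <;> by_cases hy : y ∈ X <;> simp [setRel_iff, hx, hy]
    · rintro rfl; exact hy hx
    · rintro rfl; exact hx hy
  · let w : ℕ → ℕ := fun x =>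
      Nat.findGreatest (fun y => complCount Z y ≤ complCount X x) (p (x + 1))
    have hw : ∀ x, x ∉ X → complCount Z (w x) = complCount X x ∧ w x ∉ Z := fun x hx =>
      complCount_findGreatest (by
        have := h (x + 1)
        rw [complCount_succ_of_notMem hx] at this
        omega)
    have hwp : Primrec w := Primrec.nat_findGreatest (p := fun x y => complCount Z y ≤ complCount X x)
      (hp.comp Primrec.succ)
      (Primrec.nat_le.comp ((primrec_complCount hZ).comp Primrec.snd)
        ((primrec_complCount hX).comp Primrec.fst))
    refine ⟨fun x => if x ∈ X then z₀ else w x, Primrec.ite hX (Primrec.const z₀) hwp,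
      fun x y => ?_⟩
    have hinj : x ∉ X → y ∉ X → w x = w y → x = y := fun hx hy hxy =>
      complCount_inj hx hy (by rw [← (hw x hx).1, ← (hw y hy).1, hxy])
    have hne : ∀ u v, u ∈ X → v ∉ X → u ≠ v ∧ z₀ ≠ w v := fun u v hu hv =>
      ⟨fun h => hv (h ▸ hu), fun h => (hw v hv).2 (h ▸ hz₀)⟩
    by_cases hx : x ∈ X <;> by_cases hy : y ∈ X
    · simp [setRel_iff, hx, hy]
    · simp [setRel_iff, hx, hy, (hw y hy).2, hne x y hx hy]
    · simp [setRel_iff, hx, hy, (hw x hx).2, (hne y x hy hx).1.symm, (hne y x hy hx).2.symm]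
    · simp only [setRel_iff, hx, hy, (hw x hx).2, if_false, false_and, false_or]
      exact ⟨fun h => h ▸ rfl, hinj hx hy⟩

theorem primrecPred_exists_lt {α : Type*} [Primcodable α] {R : ℕ → α → Prop} (hR : PrimrecRel R)
    {f : α → ℕ} (hf : Primrec f) : PrimrecPred fun a => ∃ x < f a, R x a :=
  (hR.exists_mem_list.comp (Primrec.list_range.comp hf) Primrec.id).of_eq (by simp)

/-! ### Stagewise approximation of the Ackermann function -/

theorem primrec_ack (e : ℕ) : Primrec (ack e) := by
  induction e with
  | zero => exact Primrec.succ.of_eq fun n => (ack_zero n).symm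
  | succ e ih =>
    refine (Primrec.nat_rec₁ (f := fun _ v => ack e v) (ack e 1)
      (ih.comp Primrec.snd)).of_eq fun n => ?_
    induction n with
    | zero => exact (ack_succ_zero e).symm
    | succ n ihn => rw [ack_succ_succ, ← ihn]

theorem exists_lt_ack {q : ℕ → ℕ} (hq : Primrec q) : ∃ e, ∀ n, q n < ack e n :=
  exists_lt_ack_of_nat_primrec (Primrec.nat_iff.1 hq)

/-- `AckStage n e x v`: the computation of `ack e x` yields `v` within `n` steps. -/
def AckStage (n e x v : ℕ) : Prop := (Code.pappAck e).evaln n x = some v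

theorem AckStage.eq_ack {n e x v : ℕ} (h : AckStage n e x v) : v = ack e x := by
  have := Code.evaln_sound (Option.mem_def.2 h)
  rw [Code.eval_pappAck] at this
  exact Part.mem_some_iff.1 this

theorem exists_ackStage (e x : ℕ) : ∃ s, ∀ n, s ≤ n → AckStage n e x (ack e x) := by
  have : ack e x ∈ (Code.pappAck e).eval x := by rw [Code.eval_pappAck]; exact Part.mem_some _
  obtain ⟨s, hs⟩ := Code.evaln_complete.1 this
  exact ⟨s, fun n hn => Code.evaln_mono hn hs⟩

theorem primrecPred_ackStage {α : Type*} [Primcodable α] {n e x v : α → ℕ} (hn : Primrec n)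
    (he : Primrec e) (hx : Primrec x) (hv : Primrec v) :
    PrimrecPred fun a => AckStage (n a) (e a) (x a) (v a) :=
  Primrec.eq.comp
    (Code.primrec_evaln.comp ((hn.pair (Code.primrec_pappAck.comp he)).pair hx))
    (Primrec.option_some.comp hv)

/-! ### The phases of the construction -/

/-- With `s = (k, n₀)`: at stage `n` some `m` has been found for which
`complCount X (ack (k / 2) (m + n₀))` and `n₀` are both less than `complCount Z m`. -/
def PhaseEnds (X Z : Set ℕ) (n : ℕ) (s : ℕ × ℕ) : Prop :=
  ∃ m < n + 1, ∃ v < n + 1,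
    AckStage n (s.1 / 2) (m + s.2) v ∧ max s.2 (complCount X v) < complCount Z m

theorem primrecRel_phaseEnds {X Z : Set ℕ} (hX : PrimrecPred fun n => n ∈ X)
    (hZ : PrimrecPred fun n => n ∈ Z) : PrimrecRel (PhaseEnds X Z) := by
  have h : PrimrecRel fun (v : ℕ) (r : ℕ × ℕ × ℕ × ℕ) =>
      AckStage r.2.1 (r.2.2.1 / 2) (r.1 + r.2.2.2) v ∧
        max r.2.2.2 (complCount X v) < complCount Z r.1 := by
    have hr : Primrec fun q : ℕ × ℕ × ℕ × ℕ × ℕ => q.2 := Primrec.snd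
    have hm := Primrec.fst.comp hr
    have hn := Primrec.fst.comp (Primrec.snd.comp hr)
    have hs := Primrec.snd.comp (Primrec.snd.comp hr)
    have hk := Primrec.fst.comp hs
    have hn₀ := Primrec.snd.comp hs
    exact (primrecPred_ackStage hn (Primrec.nat_div.comp hk (Primrec.const 2))
      (Primrec.nat_add.comp hm hn₀) Primrec.fst).and
      (Primrec.nat_lt.comp
        (Primrec.nat_max.comp hn₀ ((primrec_complCount hX).comp Primrec.fst))
        ((primrec_complCount hZ).comp hm))
  have h' : PrimrecRel fun (m : ℕ) (r : ℕ × ℕ × ℕ) => ∃ v < r.1 + 1,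
      AckStage r.1 (r.2.1 / 2) (m + r.2.2) v ∧ max r.2.2 (complCount X v) < complCount Z m :=
    primrecPred_exists_lt h (Primrec.succ.comp (Primrec.fst.comp Primrec.snd))
  exact primrecPred_exists_lt h' (Primrec.succ.comp Primrec.fst)

open Classical in
/-- The index of the current phase, and the stage at which this phase was entered. -/
noncomputable def phase (X Z : Set ℕ) : ℕ → ℕ × ℕ :=
  Nat.rec (0, 0) fun n s => if PhaseEnds X Z n s then (s.1 + 1, n + 1) else s

theorem phase_succ_of_ends {X Z : Set ℕ} {n : ℕ} (h : PhaseEnds X Z n (phase X Z n)) :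
    phase X Z (n + 1) = ((phase X Z n).1 + 1, n + 1) :=
  if_pos h

theorem phase_succ_of_not_ends {X Z : Set ℕ} {n : ℕ} (h : ¬ PhaseEnds X Z n (phase X Z n)) :
    phase X Z (n + 1) = phase X Z n :=
  if_neg h

theorem primrec_phase {X Z : Set ℕ} (hX : PrimrecPred fun n => n ∈ X)
    (hZ : PrimrecPred fun n => n ∈ Z) : Primrec (phase X Z) := by
  classical
  refine Primrec.nat_rec₁ _ (Primrec.ite ((primrecRel_phaseEnds hX hZ).comp Primrec.fst Primrec.snd)
    (Primrec.pair (Primrec.succ.comp (Primrec.fst.comp Primrec.snd))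
      (Primrec.succ.comp Primrec.fst)) Primrec.snd)

/-- Every phase is entered and ends. -/
theorem exists_phase_ends {X Z : Set ℕ} (hX : Xᶜ.Infinite)
    (hXZ : ∀ q : ℕ → ℕ, Primrec q → ∃ m, complCount X (q m) < complCount Z m) (k : ℕ) :
    ∃ n, (phase X Z n).1 = k ∧ PhaseEnds X Z n (phase X Z n) := by
  have ends : ∀ n, ∃ n', (phase X Z n').1 = (phase X Z n).1 ∧
      PhaseEnds X Z n' (phase X Z n') := by
    intro n
    by_contra! hno
    have hconst : ∀ d, phase X Z (n + d) = phase X Z n := by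
      intro d
      induction d with
      | zero => rfl
      | succ d ih =>
        rw [← add_assoc, phase_succ_of_not_ends (hno _ (by rw [ih])), ih]
    obtain ⟨e, he⟩ : ∃ e, e = (phase X Z n).1 / 2 := ⟨_, rfl⟩
    obtain ⟨n₀, hn₀⟩ : ∃ n₀, n₀ = (phase X Z n).2 := ⟨_, rfl⟩
    obtain ⟨N, hN⟩ := exists_le_complCount hX n₀
    obtain ⟨m, hm⟩ := hXZ (fun m => max N (ack e (m + n₀)))
      (Primrec.nat_max.comp (Primrec.const N)
        ((primrec_ack e).comp (Primrec.nat_add.comp Primrec.id (Primrec.const n₀))))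
    obtain ⟨s, hs⟩ := exists_ackStage e (m + n₀)
    have hv := lt_ack_right e (m + n₀)
    have hc := hconst (s + ack e (m + n₀))
    refine hno (n + (s + ack e (m + n₀))) (by rw [hc]) ?_
    rw [hc]
    refine ⟨m, by omega, ack e (m + n₀), by omega, ?_, ?_⟩
    · rw [← he, ← hn₀]
      exact hs _ (by omega)
    · rw [← hn₀]
      refine lt_of_le_of_lt (max_le ?_ ?_) hm
      · exact hN.trans (complCount_mono X (le_max_left _ _))
      · exact complCount_mono X (le_max_right _ _)
  induction k with
  | zero => exact ends 0
  | succ k ih =>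
    obtain ⟨n, hn, he⟩ := ih
    obtain ⟨n', hn', he'⟩ := ends (n + 1)
    rw [phase_succ_of_ends he, hn] at hn'
    exact ⟨n', hn', he'⟩

/-! ### The interpolating function -/

/-- In even phases this function grows towards `complCount Z ∘ p`, in odd phases it waits
for `complCount X`. -/
noncomputable def interp (X Z : Set ℕ) (p : ℕ → ℕ) : ℕ → ℕ :=
  Nat.rec 0 fun n v =>
    if (phase X Z n).1 % 2 = 0 then min (v + 1) (complCount Z (p (n + 1)))
    else max v (complCount X (n + 1))

theorem interp_succ_of_even {X Z : Set ℕ} (p : ℕ → ℕ) {n : ℕ} (h : (phase X Z n).1 % 2 = 0) :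
    interp X Z p (n + 1) = min (interp X Z p n + 1) (complCount Z (p (n + 1))) :=
  if_pos h

theorem interp_succ_of_odd {X Z : Set ℕ} (p : ℕ → ℕ) {n : ℕ} (h : (phase X Z n).1 % 2 ≠ 0) :
    interp X Z p (n + 1) = max (interp X Z p n) (complCount X (n + 1)) :=
  if_neg h

theorem primrec_interp {X Z : Set ℕ} {p : ℕ → ℕ} (hX : PrimrecPred fun n => n ∈ X)
    (hZ : PrimrecPred fun n => n ∈ Z) (hp : Primrec p) : Primrec (interp X Z p) := by
  have hn : Primrec fun q : ℕ × ℕ => q.1 + 1 := Primrec.succ.comp Primrec.fst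
  refine Primrec.nat_rec₁ 0 (Primrec.ite ?_ ?_ ?_)
  · exact Primrec.eq.comp (Primrec.nat_mod.comp
      (Primrec.fst.comp ((primrec_phase hX hZ).comp Primrec.fst)) (Primrec.const 2))
      (Primrec.const 0)
  · exact Primrec.nat_min.comp (Primrec.succ.comp Primrec.snd)
      ((primrec_complCount hZ).comp (hp.comp hn))
  · exact Primrec.nat_max.comp Primrec.snd ((primrec_complCount hX).comp hn)

section Interp

variable {X Z : Set ℕ} {p : ℕ → ℕ}

theorem interp_bounds (hmono : Monotone p)
    (hle : ∀ n, complCount X n ≤ complCount Z (p n)) (n : ℕ) :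
    complCount X n ≤ interp X Z p n ∧ interp X Z p n ≤ complCount Z (p n) := by
  induction n with
  | zero => exact ⟨(complCount_zero X).le, Nat.zero_le _⟩
  | succ n ih =>
    have h₁ := hle (n + 1)
    have h₂ := complCount_succ_le X n
    have h₃ := complCount_mono Z (hmono (Nat.le_add_right n 1))
    by_cases h : (phase X Z n).1 % 2 = 0
    · rw [interp_succ_of_even p h]; omega
    · rw [interp_succ_of_odd p h]; omega

theorem interp_step (hmono : Monotone p)
    (hle : ∀ n, complCount X n ≤ complCount Z (p n)) (n : ℕ) :
    interp X Z p n ≤ interp X Z p (n + 1) ∧ interp X Z p (n + 1) ≤ interp X Z p n + 1 := by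
  have h₀ := interp_bounds hmono hle n
  have h₂ := complCount_succ_le X n
  have h₃ := complCount_mono Z (hmono (Nat.le_add_right n 1))
  by_cases h : (phase X Z n).1 % 2 = 0
  · rw [interp_succ_of_even p h]; omega
  · rw [interp_succ_of_odd p h]; omega

theorem interp_le_self (hmono : Monotone p)
    (hle : ∀ n, complCount X n ≤ complCount Z (p n)) (n : ℕ) : interp X Z p n ≤ n := by
  induction n with
  | zero => exact le_rfl
  | succ n ih => have := (interp_step hmono hle n).2; omega

theorem complCount_le_interp_of_even (hid : ∀ n, n ≤ p n) (n : ℕ)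
    (hk : (phase X Z n).1 % 2 = 0) (m : ℕ) (hm : m + (phase X Z n).2 ≤ n) :
    complCount Z m ≤ interp X Z p (m + (phase X Z n).2) := by
  induction n generalizing m with
  | zero =>
    obtain rfl : m = 0 := by omega
    simp [complCount_zero]
  | succ n ih =>
    by_cases he : PhaseEnds X Z n (phase X Z n)
    · rw [phase_succ_of_ends he] at hm ⊢
      obtain rfl : m = 0 := by dsimp only at hm; omega
      simp [complCount_zero]
    · rw [phase_succ_of_not_ends he] at hk hm ⊢
      rcases Nat.le_or_eq_of_le_succ hm with hm | hmn
      · exact ih hk m hm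
      · rcases m with _ | m
        · simp [complCount_zero]
        · have h₁ := ih hk m (by omega)
          obtain hmn' : m + (phase X Z n).2 = n := by omega
          rw [hmn'] at h₁
          rw [hmn, Nat.succ_eq_add_one, interp_succ_of_even p hk]
          have h₂ := complCount_succ_le Z m
          have h₃ : complCount Z (m + 1) ≤ complCount Z (p (n + 1)) :=
            complCount_mono Z ((show m + 1 ≤ n + 1 by omega).trans (hid _))
          omega

theorem interp_le_of_odd (hmono : Monotone p)
    (hle : ∀ n, complCount X n ≤ complCount Z (p n)) (n : ℕ)
    (hk : (phase X Z n).1 % 2 ≠ 0) (m : ℕ) (hm : m ≤ n) :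
    interp X Z p m ≤ max (phase X Z n).2 (complCount X m) := by
  induction n generalizing m with
  | zero => exact absurd rfl hk
  | succ n ih =>
    by_cases he : PhaseEnds X Z n (phase X Z n)
    · rw [phase_succ_of_ends he]
      exact le_max_of_le_left ((interp_le_self hmono hle m).trans hm)
    · rw [phase_succ_of_not_ends he] at hk ⊢
      rcases Nat.le_or_eq_of_le_succ hm with hm | rfl
      · exact ih hk m hm
      · have h₁ := ih hk n le_rfl
        have h₂ := complCount_mono X n.le_succ
        rw [Nat.succ_eq_add_one] at *
        rw [interp_succ_of_odd p hk]
        omega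

theorem exists_complCount_ack_lt_interp (hX : Xᶜ.Infinite)
    (hXZ : ∀ q : ℕ → ℕ, Primrec q → ∃ m, complCount X (q m) < complCount Z m)
    (hid : ∀ n, n ≤ p n) (e : ℕ) : ∃ m, complCount X (ack e m) < interp X Z p m := by
  obtain ⟨n, hk, m, -, v, hv, hs, hlt⟩ := exists_phase_ends hX hXZ (2 * e)
  obtain rfl := hs.eq_ack
  have hv' := lt_ack_right ((phase X Z n).1 / 2) (m + (phase X Z n).2)
  have h₁ := complCount_le_interp_of_even (X := X) (Z := Z) hid n (by omega) m (by omega)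
  have he : (phase X Z n).1 / 2 = e := by omega
  rw [he] at hlt
  exact ⟨m + (phase X Z n).2, ((le_max_right _ _).trans_lt hlt).trans_le h₁⟩

theorem exists_interp_ack_lt_complCount (hX : Xᶜ.Infinite)
    (hXZ : ∀ q : ℕ → ℕ, Primrec q → ∃ m, complCount X (q m) < complCount Z m)
    (hmono : Monotone p) (hid : ∀ n, n ≤ p n)
    (hle : ∀ n, complCount X n ≤ complCount Z (p n)) (e : ℕ) :
    ∃ m, interp X Z p (ack e m) < complCount Z (p m) := by
  obtain ⟨n, hk, m, -, v, hv, hs, hlt⟩ := exists_phase_ends hX hXZ (2 * e + 1)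
  obtain rfl := hs.eq_ack
  have he : (phase X Z n).1 / 2 = e := by omega
  rw [he] at hlt hv
  have h₁ := interp_le_of_odd hmono hle n (by omega) _ (Nat.le_of_lt_succ hv)
  refine ⟨m + (phase X Z n).2, (h₁.trans_lt hlt).trans_le (complCount_mono Z ?_)⟩
  exact (Nat.le_add_right _ _).trans (hid _)

end Interp

end Peq

theorem theorem6p1 (X Z : Set ℕ)
    (hX : Peq.Punctual (Peq.setRel X)) (hZ : Peq.Punctual (Peq.setRel Z))
    (hXZ : Peq.StrictReducible (Peq.setRel X) (Peq.setRel Z)) :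
    ∃ Y : Set ℕ, PrimrecPred (fun n => n ∈ Y) ∧
      Peq.StrictReducible (Peq.setRel X) (Peq.setRel Y) ∧
      Peq.StrictReducible (Peq.setRel Y) (Peq.setRel Z) := by
  open Peq in
  have hXp := hX.primrecPred
  have hZp := hZ.primrecPred
  have hXinf := hX.infinite_compl
  have hnot : ∀ q : ℕ → ℕ, Primrec q → ∃ m, complCount X (q m) < complCount Z m := by
    intro q hq
    by_contra! h
    exact hXZ.2 (reducible_of_complCount_le hZp hXp hq h)
  obtain ⟨p₀, hp₀, hmono₀, hle₀⟩ := hXZ.1.exists_complCount_le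
  obtain ⟨p, hp, hmono, hid, hle⟩ : ∃ p : ℕ → ℕ, Primrec p ∧ Monotone p ∧ (∀ n, n ≤ p n) ∧
      ∀ n, complCount X n ≤ complCount Z (p n) :=
    ⟨fun n => p₀ n + n, Primrec.nat_add.comp hp₀ Primrec.id, hmono₀.add monotone_id,
      fun n => Nat.le_add_left _ _,
      fun n => (hle₀ n).trans (complCount_mono Z (Nat.le_add_right _ _))⟩
  have hh := primrec_interp hXp hZp hp
  have hbounds := interp_bounds hmono hle
  have hcount := complCount_eq_of_lipschitz (h := interp X Z p) rfl
    (fun n => (interp_step hmono hle n).1) (fun n => (interp_step hmono hle n).2)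
  have hY : PrimrecPred fun n => n ∈ {n | interp X Z p (n + 1) = interp X Z p n} :=
    Primrec.eq.comp (hh.comp Primrec.succ) hh
  have hhmono : Monotone (interp X Z p) :=
    monotone_nat_of_le_succ fun n => (interp_step hmono hle n).1
  refine ⟨{n | interp X Z p (n + 1) = interp X Z p n}, hY, ⟨?_, fun hred => ?_⟩, ?_,
    fun hred => ?_⟩
  · exact reducible_of_complCount_le hXp hY Primrec.id fun n => by
      rw [hcount]; exact (hbounds n).1
  · obtain ⟨q, hq, -, hqle⟩ := hred.exists_complCount_le
    obtain ⟨e, he⟩ := exists_lt_ack hq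
    obtain ⟨m, hm⟩ := exists_complCount_ack_lt_interp hXinf hnot hid e
    have h₁ := hqle m
    rw [hcount] at h₁
    have h₂ := complCount_mono X (he m).le
    omega
  · exact reducible_of_complCount_le hY hZp hp fun n => by
      rw [hcount]; exact (hbounds n).2
  · obtain ⟨q, hq, -, hqle⟩ := hred.exists_complCount_le
    obtain ⟨e, he⟩ := exists_lt_ack (hq.comp hp)
    obtain ⟨m, hm⟩ := exists_interp_ack_lt_complCount hXinf hnot hmono hid hle e
    have h₁ := hqle (p m)
    rw [hcount] at h₁
    have h₂ := hhmono (he m).le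
    omega
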